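/- **Definitions.** Let $I\subset\mathbb R$ be an interval with more than one point (bounded or not, containing its endpoints or not), let $Q\subset I$ be countable, put $P=I\setminus Q$, and let $f:P\to\mathbb R$ be continuous. For $a\in Q$ let $\Omega f(a)$ be the set of all real limits $\lim_j f(x_j)$ with $x_j\in P$ and $x_j\to a$, and let $\Omega^-f(a)$ and $\Omega^+f(a)$ be defined in the same way with the additional requirement $x_j\le a$, respectively $x_j\ge a$, for all $j$. For $E\subset\mathbb R^2$ write $E(a)=\{y:(a,y)\in E\}$. Let $G$ be the graph of $f$ and $\overline G$ its closure in $\mathbb R^2$. A set $H\subset I\times\mathbb R$ with $G\subset H\subset\overline G$ is a *hypergraph* (with data $I,Q,f$) if for every $a\in Q$: * $\Omega f(a)=\Omega^-f(a)=\Omega^+f(a)$ is an interval with more than one point (if $a$ is the left, respectively right, endpoint of $I$, the condition on $\Omega^-f(a)$, respectively $\Omega^+f(a)$, is dropped); * there is a continuous $g:I\setminus\{a\}\to\mathbb R$ such that $f-g$ has a finite limit at $a$ along $P$; * $H(a)$ is dense in $\overline G(a)$ and has empty interior in $\overline G(a)$. For a separable metrizable space $X$ let $\mathcal F(X)$ be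 the set of all closed subsets of $X$ and $\mathcal F_0(X)$ the set of those that are empty or zero-dimensional. For a topological embedding $e:X\to K$ in a compact metrizable space $K$, the *admissible topology* of $\mathcal F(X)$ given by $e$ is the topology induced by $F\mapsto\overline{e(F)}\in\mathcal F(K)$ from the Vietoris topology of $\mathcal F(K)$. **Corollary.** Let $H$ be a hypergraph, with data $I,Q,f$, that is a $G_\delta$ subset of $\mathbb R^2$. Then $\mathcal F_0(H)$ is a $G_\delta$ subset of $\mathcal F(H)$ for every admissible topology of $\mathcal F(H)$. If moreover $Q$ is dense in $I$, or more generally if $Q$ is not nowhere dense in $\mathbb R$, then $H$ is not a countable union $\bigcup_n F_n$ in which each $F_n$ is either compact or a closed (in $H$) zero-dimensional subset of $H$. -/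

import Mathlib

open Set Filter Topology TopologicalSpace

/-- The set of all limits `lim f (x j)`, where `x j` is a sequence of points of `S` converging
to `a`: the (real) cluster values at `a` of the restriction of `f` to `S`. -/
def clusterValues (f : ℝ → ℝ) (S : Set ℝ) (a : ℝ) : Set ℝ :=
  {y | ∃ x : ℕ → ℝ, (∀ j, x j ∈ S) ∧ Tendsto x atTop (𝓝 a) ∧
    Tendsto (fun j => f (x j)) atTop (𝓝 y)}

/-- The section `E(a) = {y | (a, y) ∈ E}` of a subset of the plane. -/
def planeSection (E : Set (ℝ × ℝ)) (a : ℝ) : Set ℝ := {y | (a, y) ∈ E}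

/-- The graph of the restriction of `f` to `S`. -/
def graphOver (f : ℝ → ℝ) (S : Set ℝ) : Set (ℝ × ℝ) := {p | p.1 ∈ S ∧ p.2 = f p.1}

/-- `H` is a hypergraph with base interval `I`, exceptional countable set `Q ⊆ I`, and graph part
the graph of `f : I \ Q → ℝ` (the values of `f` outside `I \ Q` are irrelevant). -/
structure IsHypergraph (H : Set (ℝ × ℝ)) (I Q : Set ℝ) (f : ℝ → ℝ) : Prop where
  /-- `I` is an interval, -/
  ordConnected : I.OrdConnected
  /-- and it has more than one point. -/
  nontrivial : I.Nontrivial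
  subset : Q ⊆ I
  countable : Q.Countable
  continuousOn : ContinuousOn f (I \ Q)
  /-- At each point of `Q` the cluster values of `f` form a nondegenerate interval, -/
  cluster_ordConnected : ∀ a ∈ Q, (clusterValues f (I \ Q) a).OrdConnected
  cluster_nontrivial : ∀ a ∈ Q, (clusterValues f (I \ Q) a).Nontrivial
  /-- and the left and the right cluster values are the same interval; at an endpoint
  of `I` only the side that lies in `I` is considered. -/
  cluster_left : ∀ a ∈ Q, ¬ IsLeast I a →
    clusterValues f ((I \ Q) ∩ Iic a) a = clusterValues f (I \ Q) a
  cluster_right : ∀ a ∈ Q, ¬ IsGreatest I a →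
    clusterValues f ((I \ Q) ∩ Ici a) a = clusterValues f (I \ Q) a
  /-- At each point `a` of `Q`, `f` differs from a continuous function on `I \ {a}` by a function
  that has a (finite) limit at `a`. -/
  exists_continuous_sub : ∀ a ∈ Q, ∃ g : ℝ → ℝ, ContinuousOn g (I \ {a}) ∧
    ∃ l : ℝ, Tendsto (fun x => f x - g x) (𝓝[I \ Q] a) (𝓝 l)
  graph_subset : graphOver f (I \ Q) ⊆ H
  subset_closure : H ⊆ closure (graphOver f (I \ Q))
  /-- `I` is the projection of `H` to the first factor. -/
  fst_mem : ∀ p ∈ H, p.1 ∈ I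
  /-- For `a ∈ Q`, the section of `H` at `a` is dense in the section of the closure of the graph -/
  section_dense : ∀ a ∈ Q,
    Dense ((↑) ⁻¹' planeSection H a : Set ↥(planeSection (closure (graphOver f (I \ Q))) a))
  /-- and has empty interior in it. -/
  section_interior : ∀ a ∈ Q,
    interior ((↑) ⁻¹' planeSection H a :
      Set ↥(planeSection (closure (graphOver f (I \ Q))) a)) = ∅

/-- The admissible topology on the hyperspace of all closed subsets of `X` that comes from an
embedding `e` of `X` in a compact (metrizable) space `K`: identify a closed set `F` with the
closure of `e '' F` in `K`, and use the Vietoris topology of `K`. -/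
@[reducible] def admissibleTopology {X K : Type*} [TopologicalSpace X] [TopologicalSpace K]
    (e : X → K) : TopologicalSpace (Closeds X) :=
  TopologicalSpace.induced (fun F : Closeds X => closure (e '' (F : Set X)))
    (TopologicalSpace.vietoris K)

/-- The set of all zero-dimensional closed subsets of `X` (the empty set included). -/
def zeroDimCloseds (X : Type*) [TopologicalSpace X] : Set (Closeds X) :=
  {F | HasSmallInductiveDimensionLE ↥(F : Set X) 0}

/-! Everything rests on a criterion: a closed `F ⊆ H` is zero-dimensional iff it contains no full
piece of `H` over a rational open interval `J ⊆ I`. Such a piece is connected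
(`isPreconnected_inter`) and has more than one point, so a zero-dimensional `F` cannot contain it.
Conversely, if the projection of `F` covers `J`, then `F` contains the graph over `J \ Q`, where `H`
has only graph points. These are dense in `H` over `J`, so `F` contains the whole piece. Hence, if
`F` contains no piece, its projection has dense complement, and `hasSmallInductiveDimensionLE_zero`
applies: vertical strips give clopen neighbourhoods at points off `Q`. At `a ∈ Q` one also cuts at
two heights missing from `H(a)`, using that `H` near the line over `a` follows the graph of `g + l`,
with `g` continuous off `a`. The criterion is a countable conjunction of open conditions, which
gives the `Gδ` claim. For the second claim, Baire's theorem in `H` yields some `F n` containing a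
full piece over an interval that meets `Q`. The criterion excludes zero-dimensional `F n`; the empty
interior of a dense section excludes compact `F n`. -/

/-! ### Clopen separation and countable sets of reals. -/

/-- In a second countable space with a basis of clopen sets, disjoint closed sets are separated by
a clopen set. -/
theorem exists_isClopen_separating {Y : Type*} [TopologicalSpace Y] [SecondCountableTopology Y]
    (hY : IsTopologicalBasis {s : Set Y | IsClopen s}) {A B : Set Y} (hA : IsClosed A)
    (hB : IsClosed B) (hAB : Disjoint A B) : ∃ C : Set Y, IsClopen C ∧ A ⊆ C ∧ Disjoint C B := by
  have key : ∀ y : Y, ∃ V : Set Y, IsClopen V ∧ y ∈ V ∧ (Disjoint V A ∨ Disjoint V B) := by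
    intro y
    by_cases hy : y ∈ A
    · have hyB : y ∈ Bᶜ := fun h => hAB.le_bot ⟨hy, h⟩
      obtain ⟨V, hV, hyV, hVB⟩ := hY.exists_subset_of_mem_open hyB hB.isOpen_compl
      exact ⟨V, hV, hyV, Or.inr (disjoint_left.2 fun z hz => hVB hz)⟩
    · obtain ⟨V, hV, hyV, hVA⟩ := hY.exists_subset_of_mem_open (show y ∈ Aᶜ from hy)
        hA.isOpen_compl
      exact ⟨V, hV, hyV, Or.inl (disjoint_left.2 fun z hz => hVA hz)⟩
  choose V hV hyV hVAB using key
  rcases isEmpty_or_nonempty Y with hE | hE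
  · exact ⟨∅, isClopen_empty, fun x => (hE.false x).elim, by simp⟩
  obtain ⟨T, hT, hTu⟩ := TopologicalSpace.countable_cover_nhds fun y => (hV y).isOpen.mem_nhds (hyV y)
  have hTne : T.Nonempty := by
    by_contra h
    rw [not_nonempty_iff_eq_empty] at h
    simp only [h, mem_empty_iff_false, iUnion_of_empty, iUnion_empty] at hTu
    exact (univ_nonempty (α := Y)).ne_empty hTu.symm
  obtain ⟨k, hk⟩ := hT.exists_eq_range hTne
  have hcov : ∀ y, ∃ n, y ∈ V (k n) := by
    intro y
    have := hTu.ge (mem_univ y)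
    simpa [hk] using this
  -- A clopen partition: any union of its members is clopen, since its complement is again such a
  -- union.
  let D : ℕ → Set Y := disjointed fun n => V (k n)
  have hDle : ∀ n, D n ⊆ V (k n) := fun n => disjointed_subset _ n
  have hDcl : ∀ n, IsClopen (D n) := fun n =>
    disjointedRec (p := fun s => IsClopen s) (fun t i ht => ht.diff (hV (k i))) (hV (k n))
  have hDcov : ⋃ n, D n = univ := by
    rw [iUnion_disjointed, eq_univ_iff_forall]
    exact fun y => mem_iUnion.2 (hcov y)
  let C : Set Y := ⋃ n ∈ {n | Disjoint (V (k n)) B}, D n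
  have hC : IsOpen C := isOpen_biUnion fun n _ => (hDcl n).isOpen
  have hCc : Cᶜ = ⋃ n ∈ {n | ¬ Disjoint (V (k n)) B}, D n := by
    ext y
    obtain ⟨n, hn⟩ := mem_iUnion.1 (hDcov.ge (mem_univ y))
    have huniq : ∀ m, y ∈ D m → m = n := fun m hm => by
      by_contra hmn
      exact (disjoint_disjointed (fun n => V (k n)) hmn).le_bot ⟨hm, hn⟩
    simp only [C, mem_compl_iff, mem_iUnion, exists_prop, not_exists, not_and, mem_ofPred_eq]
    constructor
    · exact fun h => ⟨n, fun h' => h n h' hn, hn⟩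
    · rintro ⟨m, hm, hym⟩ j hj hyj
      rw [huniq m hym] at hm
      rw [huniq j hyj] at hj
      exact hm hj
  refine ⟨C, ⟨⟨?_⟩, hC⟩, ?_, ?_⟩
  · rw [hCc]
    exact isOpen_biUnion fun n _ => (hDcl n).isOpen
  · intro y hy
    by_contra hyC
    rw [← mem_compl_iff, hCc] at hyC
    simp only [mem_iUnion, exists_prop, mem_ofPred_eq] at hyC
    obtain ⟨n, hn, hyn⟩ := hyC
    exact ((hVAB (k n)).resolve_right hn).le_bot ⟨hDle n hyn, hy⟩
  · simp only [C, disjoint_iUnion_left, mem_ofPred_eq]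
    exact fun n hn => hn.mono_left (hDle n)

/-- A set of reals with dense complement has a basis of clopen sets. -/
theorem isTopologicalBasis_isClopen_of_dense_compl {S : Set ℝ} (hS : Dense Sᶜ) :
    IsTopologicalBasis {s : Set S | IsClopen s} := by
  refine isTopologicalBasis_of_isOpen_of_nhds (fun s hs => hs.isOpen) fun x U hx hU => ?_
  obtain ⟨O, hO, rfl⟩ := isOpen_induced_iff.1 hU
  obtain ⟨c', d', ⟨hc', hd'⟩, hcd⟩ := mem_nhds_iff_exists_Ioo_subset.1 (hO.mem_nhds hx)
  obtain ⟨c, hc, hc1, hc2⟩ := hS.exists_between hc'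
  obtain ⟨d, hd, hd1, hd2⟩ := hS.exists_between hd'
  refine ⟨Subtype.val ⁻¹' Ioo c d, ⟨?_, isOpen_Ioo.preimage continuous_subtype_val⟩, ⟨hc2, hd1⟩,
    fun y hy => hcd ⟨hc1.trans hy.1, hy.2.trans hd2⟩⟩
  -- The endpoints lie outside `S`, so both intervals have the same trace.
  have : (Subtype.val ⁻¹' Ioo c d : Set S) = Subtype.val ⁻¹' Icc c d := by
    ext ⟨y, hy⟩
    have h1 : c ≠ y := fun h => hc (h ▸ hy)
    have h2 : y ≠ d := fun h => hd (h ▸ hy)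
    simp [h1.le_iff_lt, h2.le_iff_lt]
  rw [this]
  exact isClosed_Icc.preimage continuous_subtype_val

/-- A nonempty countable locally closed set of reals has an isolated point. -/
theorem exists_isolated_of_countable {B J : Set ℝ} (hB : B.Countable) (hne : B.Nonempty)
    (hJ : IsOpen J) (hBJ : B ⊆ J) (hcl : IsOpen (J \ B)) :
    ∃ a ∈ B, ∀ᶠ t in 𝓝 a, t ∈ B → t = a := by
  -- `B` is thus a Baire space and a countable union of singletons, one of which must be open.
  have hG : IsGδ B := by
    have : B = J ∩ (J \ B)ᶜ := by
      ext x; constructor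
      · exact fun h => ⟨hBJ h, fun h' => h'.2 h⟩
      · rintro ⟨h1, h2⟩; by_contra h; exact h2 ⟨h1, h⟩
    rw [this]
    exact hJ.isGδ.inter hcl.isClosed_compl.isGδ
  have : BaireSpace B := hG.baireSpace_of_t2Space_locallyCompactSpace
  have : Countable B := hB
  have : Nonempty B := hne.to_subtype
  obtain ⟨b, x, hx⟩ := nonempty_interior_of_iUnion_of_closed (f := fun b : B => ({b} : Set B))
    (fun b => isClosed_singleton) (by ext; simp)
  have hxb : x ∈ ({b} : Set B) := interior_subset hx
  rw [mem_singleton_iff] at hxb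
  subst hxb
  rw [mem_interior_iff_mem_nhds, nhds_subtype_eq_comap] at hx
  obtain ⟨O, hO, hOb⟩ := hx
  refine ⟨x, x.2, ?_⟩
  filter_upwards [hO] with t ht htB
  exact congrArg Subtype.val (hOb (show (⟨t, htB⟩ : B) ∈ Subtype.val ⁻¹' O from ht))

theorem planeSection_closure_graphOver (f : ℝ → ℝ) (S : Set ℝ) (a : ℝ) :
    planeSection (closure (graphOver f S)) a = clusterValues f S a := by
  ext y
  simp only [planeSection, clusterValues, mem_ofPred_eq, mem_closure_iff_seq_limit]
  constructor
  · rintro ⟨x, hx, hlim⟩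
    refine ⟨fun j => (x j).1, fun j => (hx j).1, (continuous_fst.tendsto _).comp hlim, ?_⟩
    have := (continuous_snd.tendsto _).comp hlim
    exact this.congr fun j => (hx j).2
  · rintro ⟨x, hx, h1, h2⟩
    exact ⟨fun j => (x j, f (x j)), fun j => ⟨hx j, rfl⟩, h1.prodMk_nhds h2⟩

namespace IsHypergraph

variable {H : Set (ℝ × ℝ)} {I Q : Set ℝ} {f : ℝ → ℝ}

theorem mem_clusterValues (h : IsHypergraph H I Q f) {a y : ℝ} (hy : (a, y) ∈ H) :
    y ∈ clusterValues f (I \ Q) a := by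
  rw [← planeSection_closure_graphOver]
  exact h.subset_closure hy

theorem exists_mem (h : IsHypergraph H I Q f) {a : ℝ} (ha : a ∈ I) : ∃ y, (a, y) ∈ H := by
  by_cases hQ : a ∈ Q
  · have hne : (planeSection (closure (graphOver f (I \ Q))) a).Nonempty := by
      rw [planeSection_closure_graphOver]
      exact (h.cluster_nontrivial a hQ).nonempty
    have := hne.to_subtype
    obtain ⟨y, hy⟩ := (h.section_dense a hQ).nonempty
    exact ⟨y, hy⟩
  · exact ⟨f a, h.graph_subset ⟨⟨ha, hQ⟩, rfl⟩⟩

/-! ### Connectedness of `H` over open intervals. -/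

/-- Near a point of continuity, `H` is contained in a given neighbourhood of the graph. -/
theorem eventually_forall_mem (h : IsHypergraph H I Q f) {x : ℝ} (hx : x ∈ I \ Q)
    {W : Set (ℝ × ℝ)} (hW : W ∈ 𝓝 (x, f x)) :
    ∀ᶠ t in 𝓝 x, ∀ y, (t, y) ∈ H → (t, y) ∈ W := by
  rw [nhds_prod_eq, Filter.mem_prod_iff] at hW
  obtain ⟨A, hA, B, hB, hAB⟩ := hW
  obtain ⟨B', hB', hB'c, hB'B⟩ := exists_mem_nhds_isClosed_subset hB
  have hcont := h.continuousOn x hx hB'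
  rw [mem_map, mem_nhdsWithin_iff_eventually, eventually_nhds_iff] at hcont
  obtain ⟨O, hO, hOo, hxO⟩ := hcont
  filter_upwards [hA, hOo.mem_nhds hxO] with t htA htO y hy
  refine hAB ⟨htA, hB'B ?_⟩
  by_contra hyB
  obtain ⟨⟨s, z⟩, ⟨hs, hz⟩, hsP, hzf⟩ := mem_closure_iff.1 (h.subset_closure hy) (O ×ˢ B'ᶜ)
    (hOo.prod hB'c.isOpen_compl) ⟨htO, hyB⟩
  simp only at hzf hs hz
  subst hzf
  exact hz (hO s hs hsP)

/-- If, on the side `T` of `a ∈ Q`, the cluster values are all of them and `H` lies in `U` over `T`,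
then a point of `H` over `a` is not in an open set that is disjoint from `U` on `H`. -/
theorem notMem_of_eventually_mem (h : IsHypergraph H I Q f) {a : ℝ} (haQ : a ∈ Q) {T : Set ℝ}
    (hT : clusterValues f ((I \ Q) ∩ T) a = clusterValues f (I \ Q) a) {U V : Set (ℝ × ℝ)}
    (hV : IsOpen V)
    (hUT : ∀ᶠ t in 𝓝 a, t ≠ a → t ∈ T → ∀ y, (t, y) ∈ H → (t, y) ∈ U)
    (hUV : ∀ᶠ t in 𝓝 a, ∀ y, (t, y) ∈ H → (t, y) ∈ U → (t, y) ∉ V)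
    {y : ℝ} (hy : (a, y) ∈ H) : (a, y) ∉ V := by
  intro hyV
  have := h.mem_clusterValues hy
  rw [← hT] at this
  obtain ⟨x, hx, h1, h2⟩ := this
  have h3 : Tendsto (fun j => (x j, f (x j))) atTop (𝓝 (a, y)) := h1.prodMk_nhds h2
  obtain ⟨j, hj1, hj2, hj3⟩ := ((h1.eventually hUT).and
    ((h1.eventually hUV).and (h3.eventually (hV.mem_nhds hyV)))).exists
  have hmem : (x j, f (x j)) ∈ H := h.graph_subset ⟨(hx j).1, rfl⟩
  have hne : x j ≠ a := fun e => (hx j).1.2 (e ▸ haQ)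
  exact hj2 _ hmem (hj1 hne (hx j).2 _ hmem) hj3

/-- Suppose `U` and `V` split the piece. The abscissae near which `H` lies neither in `U` alone nor
in `V` alone form a countable, relatively closed set `B ⊆ Q`. If nonempty, it has an isolated point
`a`, and on each side of `a` the set `H` lies in just one of `U`, `V`. Equality of the one-sided
cluster sets carries this choice to the line over `a`, a contradiction. -/
theorem isPreconnected_inter (h : IsHypergraph H I Q f) {p q : ℝ} (hI : Ioo p q ⊆ I) :
    IsPreconnected (H ∩ Prod.fst ⁻¹' Ioo p q) := by
  rw [isPreconnected_iff_subset_of_disjoint]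
  intro U V hU hV hUV hdisj
  let N : Set (ℝ × ℝ) → Set ℝ := fun W => {x | ∀ᶠ t in 𝓝 x, ∀ y, (t, y) ∈ H → (t, y) ∈ W}
  have hNo : ∀ W, IsOpen (N W) := fun W => isOpen_iff_mem_nhds.2 fun x hx =>
    eventually_eventually_nhds.2 hx
  have hNself : ∀ {W x}, x ∈ N W → ∀ y, (x, y) ∈ H → (x, y) ∈ W := fun hx => hx.self_of_nhds
  have hdis : ∀ x ∈ Ioo p q, ∀ y, (x, y) ∈ H → (x, y) ∈ U → (x, y) ∉ V :=
    fun x hx y hy hyU hyV => hdisj.le ⟨⟨hy, hx⟩, hyU, hyV⟩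
  have hmono : ∀ s : Set ℝ, IsPreconnected s → s ⊆ Ioo p q → s ⊆ N U ∪ N V →
      s ⊆ N U ∨ s ⊆ N V := by
    intro s hs hsJ hsN
    refine isPreconnected_iff_subset_of_disjoint.1 hs _ _ (hNo U) (hNo V) hsN ?_
    refine eq_empty_iff_forall_notMem.2 ?_
    rintro x ⟨hxs, hxU, hxV⟩
    obtain ⟨y, hy⟩ := h.exists_mem (hI (hsJ hxs))
    exact hdis x (hsJ hxs) y hy (hNself hxU y hy) (hNself hxV y hy)
  suffices hall : Ioo p q ⊆ N U ∪ N V by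
    rcases hmono _ isPreconnected_Ioo subset_rfl hall with h' | h'
    · exact Or.inl fun z hz => hNself (h' hz.2) z.2 hz.1
    · exact Or.inr fun z hz => hNself (h' hz.2) z.2 hz.1
  let B := Ioo p q \ (N U ∪ N V)
  by_contra hcon
  have hBne : B.Nonempty := by
    obtain ⟨x, hx, hx'⟩ := not_subset.1 hcon
    exact ⟨x, hx, hx'⟩
  have hBQ : B ⊆ Q := by
    rintro x ⟨hxJ, hxN⟩
    by_contra hxQ
    have hxP : x ∈ I \ Q := ⟨hI hxJ, hxQ⟩
    rcases hUV (show (x, f x) ∈ _ from ⟨h.graph_subset ⟨hxP, rfl⟩, hxJ⟩) with hx | hx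
    · exact hxN (Or.inl (h.eventually_forall_mem hxP (hU.mem_nhds hx)))
    · exact hxN (Or.inr (h.eventually_forall_mem hxP (hV.mem_nhds hx)))
  obtain ⟨a, haB, hiso⟩ := exists_isolated_of_countable (h.countable.mono hBQ) hBne isOpen_Ioo
    sdiff_subset (by
      rw [sdiff_sdiff_right_self]
      exact isOpen_Ioo.inter ((hNo U).union (hNo V)))
  have haQ := hBQ haB
  obtain ⟨c, d, ⟨hca, had⟩, hcd⟩ := mem_nhds_iff_exists_Ioo_subset.1
    (inter_mem (isOpen_Ioo.mem_nhds haB.1) hiso)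
  have hleft : Ioo c a ⊆ N U ∨ Ioo c a ⊆ N V := by
    refine hmono _ isPreconnected_Ioo (fun t ht => (hcd ⟨ht.1, ht.2.trans had⟩).1) fun t ht => ?_
    have ht' := hcd ⟨ht.1, ht.2.trans had⟩
    by_contra hN
    exact ht.2.ne (ht'.2 ⟨ht'.1, hN⟩)
  have hright : Ioo a d ⊆ N U ∨ Ioo a d ⊆ N V := by
    refine hmono _ isPreconnected_Ioo (fun t ht => (hcd ⟨hca.trans ht.1, ht.2⟩).1) fun t ht => ?_
    have ht' := hcd ⟨hca.trans ht.1, ht.2⟩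
    by_contra hN
    exact ht.1.ne' (ht'.2 ⟨ht'.1, hN⟩)
  have haL : ¬ IsLeast I a := fun hl => by
    have hm : (p + a) / 2 ∈ Ioo p q := ⟨by linarith [haB.1.1], by linarith [haB.1.1, haB.1.2]⟩
    linarith [hl.2 (hI hm), haB.1.1]
  have haG : ¬ IsGreatest I a := fun hl => by
    have hm : (a + q) / 2 ∈ Ioo p q := ⟨by linarith [haB.1.1, haB.1.2], by linarith [haB.1.2]⟩
    linarith [hl.2 (hI hm), haB.1.2]
  have hJn : Ioo p q ∈ 𝓝 a := isOpen_Ioo.mem_nhds haB.1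
  have hL : ∀ W W', IsOpen W' → (∀ x ∈ Ioo p q, ∀ y, (x, y) ∈ H → (x, y) ∈ W → (x, y) ∉ W') →
      Ioo c a ⊆ N W → ∀ y, (a, y) ∈ H → (a, y) ∉ W' := by
    intro W W' hW' hWW hN y hy
    refine h.notMem_of_eventually_mem haQ (h.cluster_left a haQ haL) hW' (U := W) ?_ ?_ hy
    · filter_upwards [Ioi_mem_nhds hca] with t ht hta htT
      exact hNself (hN ⟨ht, lt_of_le_of_ne htT hta⟩)
    · filter_upwards [hJn] with t ht using hWW t ht
  have hR : ∀ W W', IsOpen W' → (∀ x ∈ Ioo p q, ∀ y, (x, y) ∈ H → (x, y) ∈ W → (x, y) ∉ W') →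
      Ioo a d ⊆ N W → ∀ y, (a, y) ∈ H → (a, y) ∉ W' := by
    intro W W' hW' hWW hN y hy
    refine h.notMem_of_eventually_mem haQ (h.cluster_right a haQ haG) hW' (U := W) ?_ ?_ hy
    · filter_upwards [Iio_mem_nhds had] with t ht hta htT
      exact hNself (hN ⟨lt_of_le_of_ne htT (Ne.symm hta), ht⟩)
    · filter_upwards [hJn] with t ht using hWW t ht
  have hdis' : ∀ x ∈ Ioo p q, ∀ y, (x, y) ∈ H → (x, y) ∈ V → (x, y) ∉ U :=
    fun x hx y hy h1 h2 => hdis x hx y hy h2 h1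
  have hboth : ∀ W, Ioo c a ⊆ N W → Ioo a d ⊆ N W → (∀ y, (a, y) ∈ H → (a, y) ∈ W) → a ∈ N W := by
    intro W h1 h2 h3
    filter_upwards [Ioo_mem_nhds hca had] with t ht y hy
    rcases lt_trichotomy t a with hta | rfl | hta
    · exact hNself (h1 ⟨ht.1, hta⟩) y hy
    · exact h3 y hy
    · exact hNself (h2 ⟨hta, ht.2⟩) y hy
  obtain ⟨y₀, hy₀⟩ := h.exists_mem (hI haB.1)
  have hcov : ∀ y, (a, y) ∈ H → (a, y) ∈ U ∨ (a, y) ∈ V := fun y hy => hUV ⟨hy, haB.1⟩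
  rcases hleft with hl | hl <;> rcases hright with hr | hr
  · exact haB.2 (Or.inl (hboth U hl hr fun y hy =>
      (hcov y hy).resolve_right (hL U V hV hdis hl y hy)))
  -- With different sets on the two sides, a point over `a` could lie in neither.
  · exact (hcov y₀ hy₀).elim (hR V U hU hdis' hr y₀ hy₀) (hL U V hV hdis hl y₀ hy₀)
  · exact (hcov y₀ hy₀).elim (hL V U hU hdis' hl y₀ hy₀) (hR U V hV hdis hr y₀ hy₀)
  · exact haB.2 (Or.inr (hboth V hl hr fun y hy =>
      (hcov y hy).resolve_left (hL V U hU hdis' hl y hy)))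

/-! ### Zero-dimensionality of subsets with thin projection. -/

/-- Supplies the heights at which `H` can be cut over `a`. -/
theorem exists_notMem_Ioo (h : IsHypergraph H I Q f) {a : ℝ} (ha : a ∈ Q) {r s : ℝ}
    (hrs : r < s) : ∃ y ∈ Ioo r s, (a, y) ∉ H := by
  by_contra! hcon
  obtain ⟨y, hy⟩ := exists_between hrs
  have hyH := hcon y hy
  let y' : ↥(planeSection (closure (graphOver f (I \ Q))) a) := ⟨y, h.subset_closure hyH⟩
  have hy' : y' ∈ interior ((↑) ⁻¹' planeSection H a :
      Set ↥(planeSection (closure (graphOver f (I \ Q))) a)) :=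
    mem_interior.2 ⟨Subtype.val ⁻¹' Ioo r s, fun z hz => hcon z hz,
      isOpen_Ioo.preimage continuous_subtype_val, hy⟩
  rw [h.section_interior a ha] at hy'
  exact hy'

/-- If `f - g` tends to `l` at `a`, then `H` is close to the graph of `g + l` near the vertical line
over `a`. -/
theorem eventually_abs_sub_le (h : IsHypergraph H I Q f) {a l : ℝ} {g : ℝ → ℝ}
    (hg : ContinuousOn g (I \ {a})) (hl : Tendsto (fun x => f x - g x) (𝓝[I \ Q] a) (𝓝 l))
    (ha : a ∈ Q) {ε : ℝ} (hε : 0 < ε) :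
    ∀ᶠ t in 𝓝 a, t ≠ a → ∀ y, (t, y) ∈ H → |y - (g t + l)| ≤ ε := by
  -- A closed ball, so that the bound survives the limit `x j → t`.
  have h1 := hl (Metric.closedBall_mem_nhds l hε)
  rw [mem_map, mem_nhdsWithin_iff_eventually] at h1
  filter_upwards [eventually_eventually_nhds.2 h1] with t ht hta y hy
  have htI : t ∈ I := h.fst_mem _ hy
  obtain ⟨x, hx, hx1, hx2⟩ := h.mem_clusterValues hy
  have hxg : Tendsto (fun j => g (x j)) atTop (𝓝 (g t)) :=
    (hg t ⟨htI, hta⟩).tendsto.comp (tendsto_nhdsWithin_iff.2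
      ⟨hx1, Eventually.of_forall fun j => ⟨(hx j).1, fun e => (hx j).2 (e ▸ ha)⟩⟩)
  have hlim : Tendsto (fun j => |f (x j) - g (x j) - l|) atTop (𝓝 |y - g t - l|) :=
    ((hx2.sub hxg).sub_const l).abs
  rw [← sub_sub]
  refine le_of_tendsto hlim ?_
  filter_upwards [hx1.eventually ht] with j hj
  exact hj (hx j)

/-- A subset of `H` (given as an inducing map) whose projection has dense complement is
zero-dimensional. -/
theorem hasSmallInductiveDimensionLE_zero (h : IsHypergraph H I Q f) {X : Type*}
    [TopologicalSpace X] {φ : X → ℝ × ℝ} (hφ : IsInducing φ) (hφH : ∀ x, φ x ∈ H)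
    (hS : Dense (range fun x => (φ x).1)ᶜ) : HasSmallInductiveDimensionLE X 0 := by
  refine hasSmallInductiveDimensionLT_one_iff.2 ?_
  have hu : Continuous fun x => (φ x).1 := continuous_fst.comp hφ.continuous
  have hv : Continuous fun x => (φ x).2 := continuous_snd.comp hφ.continuous
  -- vertical strips
  have hstrip : ∀ c d, c ∉ range (fun x => (φ x).1) → d ∉ range (fun x => (φ x).1) →
      IsClopen {x | (φ x).1 ∈ Ioo c d} := by
    intro c d hc hd
    refine ⟨?_, isOpen_Ioo.preimage hu⟩
    have : {x | (φ x).1 ∈ Ioo c d} = {x | (φ x).1 ∈ Icc c d} := by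
      ext x
      have h1 : c ≠ (φ x).1 := fun e => hc ⟨x, e.symm⟩
      have h2 : (φ x).1 ≠ d := fun e => hd ⟨x, e⟩
      simp [h1.le_iff_lt, h2.le_iff_lt]
    rw [this]
    exact isClosed_Icc.preimage hu
  have hbetween : ∀ t : ℝ, ∀ O ∈ 𝓝 t, ∃ c d, c ∉ range (fun x => (φ x).1) ∧
      d ∉ range (fun x => (φ x).1) ∧ t ∈ Ioo c d ∧ Ioo c d ⊆ O := by
    intro t O hO
    obtain ⟨c', d', ⟨hc', hd'⟩, hcd⟩ := mem_nhds_iff_exists_Ioo_subset.1 hO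
    obtain ⟨c, hc, hc1, hc2⟩ := hS.exists_between hc'
    obtain ⟨d, hd, hd1, hd2⟩ := hS.exists_between hd'
    exact ⟨c, d, hc, hd, ⟨hc2, hd1⟩, fun y hy => hcd ⟨hc1.trans hy.1, hy.2.trans hd2⟩⟩
  refine isTopologicalBasis_of_isOpen_of_nhds (fun s hs => hs.isOpen) fun x₀ U hx₀ hU => ?_
  obtain ⟨W, hW, rfl⟩ := hφ.isOpen_iff.1 hU
  have hWn : W ∈ 𝓝 (φ x₀) := hW.mem_nhds hx₀
  obtain ⟨⟨a, y₀⟩, hx⟩ : ∃ z, φ x₀ = z := ⟨_, rfl⟩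
  have hax : (φ x₀).1 = a := by rw [hx]
  have hH₀ : (a, y₀) ∈ H := hx ▸ hφH x₀
  have haI : a ∈ I := h.fst_mem _ hH₀
  by_cases haQ : a ∈ Q
  swap
  · have hy₀ : y₀ = f a := by
      obtain ⟨x, hxs, hx1, hx2⟩ := h.mem_clusterValues hH₀
      exact tendsto_nhds_unique hx2 ((h.continuousOn a ⟨haI, haQ⟩).tendsto.comp
        (tendsto_nhdsWithin_iff.2 ⟨hx1, Eventually.of_forall hxs⟩))
    rw [hx, hy₀] at hWn
    obtain ⟨c, d, hc, hd, hacd, hcd⟩ := hbetween a _ (h.eventually_forall_mem ⟨haI, haQ⟩ hWn)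
    refine ⟨{x | (φ x).1 ∈ Ioo c d}, hstrip c d hc hd, ?_, fun x hxm => hcd hxm _ (hφH x)⟩
    rw [mem_ofPred_eq, hax]
    exact hacd
  rw [hx, nhds_prod_eq, Filter.mem_prod_iff] at hWn
  obtain ⟨A, hA, B, hB, hAB⟩ := hWn
  obtain ⟨α, β, ⟨hα, hβ⟩, hαβ⟩ := mem_nhds_iff_exists_Ioo_subset.1 hB
  obtain ⟨y₁, ⟨hαy₁, hy₁⟩, hy₁H⟩ := h.exists_notMem_Ioo haQ hα
  obtain ⟨y₂, ⟨hy₂, hy₂β⟩, hy₂H⟩ := h.exists_notMem_Ioo haQ hβ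
  obtain ⟨g, hg, l, hl⟩ := h.exists_continuous_sub a haQ
  -- separate the abscissae off `a` according to the values of `g + l`
  let S : Set ℝ := range (fun x => (φ x).1) \ {a}
  have hSI : ∀ t ∈ S, t ∈ I \ {a} := by
    rintro _ ⟨⟨x, rfl⟩, hxa⟩
    exact ⟨h.fst_mem _ (hφH x), hxa⟩
  have hγ : Continuous fun t : S => g t + l :=
    (continuousOn_iff_continuous_domRestrict.1 (hg.mono hSI)).add continuous_const
  have hab : Continuous fun t : S => |(t : ℝ) - a| := by fun_prop
  -- The margin `|t - a|` is positive off `a`, which makes the two closed sets disjoint, and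
  -- vanishes at `a`, so that the cut tightens to `y₁`, `y₂` there.
  obtain ⟨C, hC, hAC, hBC⟩ := exists_isClopen_separating
    (isTopologicalBasis_isClopen_of_dense_compl (S := S)
      (hS.mono (compl_subset_compl.2 sdiff_subset)))
    (A := {t | g t + l ∈ Icc y₁ y₂})
    (B := {t | g t + l ≤ y₁ - |(t : ℝ) - a|} ∪ {t | y₂ + |(t : ℝ) - a| ≤ g t + l})
    (isClosed_Icc.preimage hγ)
    ((isClosed_le hγ (continuous_const.sub hab)).union (isClosed_le (continuous_const.add hab) hγ))
    (by
      rw [disjoint_left]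
      rintro ⟨t, htS, hta⟩ ⟨h1, h2⟩ h3
      have : 0 < |t - a| := abs_pos.2 (sub_ne_zero.2 hta)
      rcases h3 with h3 | h3
      · rw [mem_ofPred_eq] at h3; dsimp only at h1 h2 h3; linarith
      · rw [mem_ofPred_eq] at h3; dsimp only at h1 h2 h3; linarith)
  obtain ⟨O, hO, hOC⟩ := isOpen_induced_iff.1 hC.isOpen
  obtain ⟨O', hO', hOC'⟩ := isOpen_induced_iff.1 hC.compl.isOpen
  have hOO' : ∀ t ∈ S, t ∈ O' ↔ t ∉ O := by
    intro t ht
    have h1 : (⟨t, ht⟩ : S) ∈ C ↔ t ∈ O := by rw [← hOC]; rfl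
    have h2 : (⟨t, ht⟩ : S) ∈ Cᶜ ↔ t ∈ O' := by rw [← hOC']; rfl
    rw [← h1, ← h2]; rfl
  have hOA : ∀ t ∈ S, g t + l ∈ Icc y₁ y₂ → t ∈ O := by
    intro t ht htg
    have := hAC (show (⟨t, ht⟩ : S) ∈ {t : S | g t + l ∈ Icc y₁ y₂} from htg)
    rwa [← hOC] at this
  have hOB : ∀ t ∈ S, t ∈ O → y₁ - |t - a| < g t + l ∧ g t + l < y₂ + |t - a| := by
    intro t ht htO
    have htC : (⟨t, ht⟩ : S) ∈ C := by rw [← hOC]; exact htO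
    have := disjoint_left.1 hBC htC
    simp only [mem_union, mem_ofPred_eq, not_or, not_le] at this
    exact this
  have hclose : ∀ ε > 0, ∀ᶠ t in 𝓝 a, |t - a| < ε ∧
      (t ≠ a → ∀ y, (t, y) ∈ H → |y - (g t + l)| ≤ ε) := fun ε hε =>
    Filter.Eventually.and (Metric.ball_mem_nhds a hε) (h.eventually_abs_sub_le hg hl haQ hε)
  have hclose' : ∀ x, (φ x).1 = a → ∀ ε > 0, ∀ᶠ z in 𝓝 x, |(φ z).1 - a| < ε ∧
      ((φ z).1 ≠ a → ∀ y, ((φ z).1, y) ∈ H → |y - ((g (φ z).1) + l)| ≤ ε) := fun x hxa ε hε =>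
    (hxa ▸ hu.tendsto x : Tendsto (fun z => (φ z).1) (𝓝 x) (𝓝 a)).eventually (hclose ε hε)
  -- Clopen over `a` because no point of `H` there has height `y₁` or `y₂`, while nearby heights
  -- follow `g + l`.
  let M : Set X := {x | ((φ x).1 ≠ a ∧ (φ x).1 ∈ O) ∨ ((φ x).1 = a ∧ (φ x).2 ∈ Ioo y₁ y₂)}
  have hM : IsClopen M := by
    refine ⟨⟨isOpen_iff_mem_nhds.2 fun x hxM => ?_⟩, isOpen_iff_mem_nhds.2 fun x hxM => ?_⟩
    · by_cases hxa : (φ x).1 = a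
      · have hyM : (φ x).2 ∉ Ioo y₁ y₂ := fun hy => hxM (Or.inr ⟨hxa, hy⟩)
        have hxH : (a, (φ x).2) ∈ H := hxa ▸ hφH x
        have hne1 : (φ x).2 ≠ y₁ := fun e => hy₁H (e ▸ hxH)
        have hne2 : (φ x).2 ≠ y₂ := fun e => hy₂H (e ▸ hxH)
        rcases lt_or_gt_of_ne hne1 with hlt | hgt
        -- Three errors below `ε` or equal to it: the change of height, the distance to `g + l`, and
        -- the margin `|t - a|`.
        · have hε : 0 < (y₁ - (φ x).2) / 3 := by linarith
          have hc := hclose' x hxa _ hε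
          filter_upwards [hc, hv.continuousAt.eventually (Metric.ball_mem_nhds _ hε)]
            with z hz1 hz2 hzM
          rw [Real.dist_eq, abs_lt] at hz2
          rcases hzM with ⟨hza, hzO⟩ | ⟨hza, hz⟩
          · have := abs_le.1 (hz1.2 hza _ (hφH z))
            have := hOB _ ⟨⟨z, rfl⟩, hza⟩ hzO
            linarith
          · linarith [hz.1]
        · have hgt2 : y₂ < (φ x).2 := lt_of_le_of_ne
            (not_lt.1 fun h' => hyM ⟨hgt, h'⟩) hne2.symm
          have hε : 0 < ((φ x).2 - y₂) / 3 := by linarith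
          have hc := hclose' x hxa _ hε
          filter_upwards [hc, hv.continuousAt.eventually (Metric.ball_mem_nhds _ hε)]
            with z hz1 hz2 hzM
          rw [Real.dist_eq, abs_lt] at hz2
          rcases hzM with ⟨hza, hzO⟩ | ⟨hza, hz⟩
          · have := abs_le.1 (hz1.2 hza _ (hφH z))
            have := hOB _ ⟨⟨z, rfl⟩, hza⟩ hzO
            linarith
          · linarith [hz.2]
      · have hxO : (φ x).1 ∈ O' := (hOO' _ ⟨⟨x, rfl⟩, hxa⟩).2 fun hO => hxM (Or.inl ⟨hxa, hO⟩)
        filter_upwards [hu.continuousAt.eventually (hO'.mem_nhds hxO),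
          hu.continuousAt.eventually (isOpen_ne.mem_nhds hxa)] with z hz1 hz2 hzM
        rcases hzM with hzM | hzM
        · exact (hOO' _ ⟨⟨z, rfl⟩, hz2⟩).1 hz1 hzM.2
        · exact hz2 hzM.1
    · rcases hxM with ⟨hxa, hxO⟩ | ⟨hxa, hxy1, hxy2⟩
      · filter_upwards [hu.continuousAt.eventually (hO.mem_nhds hxO),
          hu.continuousAt.eventually (isOpen_ne.mem_nhds hxa)] with z hz1 hz2
        exact Or.inl ⟨hz2, hz1⟩
      · obtain ⟨ε, hε, hε1⟩ : ∃ ε > 0, ε < min ((φ x).2 - y₁) (y₂ - (φ x).2) / 2 :=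
          exists_between (half_pos (lt_min (sub_pos.2 hxy1) (sub_pos.2 hxy2)))
        have hε2 := min_le_left ((φ x).2 - y₁) (y₂ - (φ x).2)
        have hε3 := min_le_right ((φ x).2 - y₁) (y₂ - (φ x).2)
        have hc := hclose' x hxa _ hε
        filter_upwards [hc, hv.continuousAt.eventually (Metric.ball_mem_nhds _ hε)]
          with z hz1 hz2
        rw [Real.dist_eq, abs_lt] at hz2
        by_cases hza : (φ z).1 = a
        · exact Or.inr ⟨hza, by linarith, by linarith⟩
        · have := abs_le.1 (hz1.2 hza _ (hφH z))
          exact Or.inl ⟨hza, hOA _ ⟨⟨z, rfl⟩, hza⟩ ⟨by linarith, by linarith⟩⟩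
  -- Off the line over `a`, points of `M` leave `[y₁, y₂]` by less than `2ε`: the margin plus the
  -- distance to `g + l`.
  obtain ⟨ε, hε, hε1⟩ : ∃ ε > 0, ε < min (y₁ - α) (β - y₂) / 2 :=
    exists_between (half_pos (lt_min (sub_pos.2 hαy₁) (sub_pos.2 hy₂β)))
  have hε2 := min_le_left (y₁ - α) (β - y₂)
  have hε3 := min_le_right (y₁ - α) (β - y₂)
  obtain ⟨c, d, hc, hd, hacd, hcd⟩ := hbetween a _ (inter_mem hA (hclose ε hε))
  refine ⟨M ∩ {x | (φ x).1 ∈ Ioo c d}, hM.inter (hstrip c d hc hd), ⟨Or.inr ⟨hax, ?_⟩, ?_⟩, ?_⟩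
  · rw [hx]; exact ⟨hy₁, hy₂⟩
  · rw [mem_ofPred_eq, hax]; exact hacd
  · rintro x ⟨hxM, hxcd⟩
    obtain ⟨hxA, hx1, hx2⟩ := hcd hxcd
    refine hAB ⟨hxA, hαβ ?_⟩
    rcases hxM with ⟨hxa, hxO⟩ | ⟨hxa, hxy1, hxy2⟩
    · have h1 := abs_le.1 (hx2 hxa _ (hφH x))
      have h2 := hOB _ ⟨⟨x, rfl⟩, hxa⟩ hxO
      exact ⟨by linarith, by linarith⟩
    · exact ⟨hαy₁.trans hxy1, hxy2.trans hy₂β⟩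

/-! ### The criterion and the `Gδ` property. -/

/-- A closed subset of `H` is zero-dimensional if and only if it contains no part of `H` over
an interval with rational endpoints. -/
theorem hasSmallInductiveDimensionLE_zero_iff (h : IsHypergraph H I Q f) {F : Set H}
    (hF : IsClosed F) : HasSmallInductiveDimensionLE F 0 ↔
      ∀ p q : ℚ, p < q → Ioo (p : ℝ) q ⊆ I → ∃ x : H, x.1.1 ∈ Ioo (p : ℝ) q ∧ x ∉ F := by
  constructor
  · intro hdim p q hpq hI
    by_contra! hcon
    have : TotallySeparatedSpace F := by
      have hb := hasSmallInductiveDimensionLT_one_iff.1 hdim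
      exact totallySeparatedSpace_of_t0_of_basis_clopen hb
    have hind : IsInducing fun x : F => (x : H).1 :=
      IsInducing.subtypeVal.comp IsInducing.subtypeVal
    have hpre : IsPreconnected {x : F | x.1.1.1 ∈ Ioo (p : ℝ) q} := by
      rw [← hind.isPreconnected_image]
      convert h.isPreconnected_inter hI using 1
      ext z
      constructor
      · rintro ⟨x, hx, rfl⟩
        exact ⟨x.1.2, hx⟩
      · rintro ⟨hzH, hz⟩
        exact ⟨⟨⟨z, hzH⟩, hcon ⟨z, hzH⟩ hz⟩, hz, rfl⟩
    obtain ⟨s, hs⟩ := exists_between (show (p : ℝ) < q by exact_mod_cast hpq)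
    obtain ⟨t, ht⟩ := exists_between hs.2
    have htI : t ∈ Ioo (p : ℝ) q := ⟨hs.1.trans ht.1, ht.2⟩
    obtain ⟨y, hy⟩ := h.exists_mem (hI hs)
    obtain ⟨z, hz⟩ := h.exists_mem (hI htI)
    have := hpre.subsingleton (x := ⟨⟨(s, y), hy⟩, hcon _ hs⟩) hs
      (y := ⟨⟨(t, z), hz⟩, hcon _ htI⟩) htI
    simp only [Subtype.mk.injEq, Prod.mk.injEq] at this
    exact ht.1.ne this.1
  · intro hF'
    refine h.hasSmallInductiveDimensionLE_zero (φ := fun x : F => (x : H).1)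
      (IsInducing.subtypeVal.comp IsInducing.subtypeVal) (fun x => x.1.2) ?_
    rw [dense_iff_inter_open]
    by_contra! hcon
    obtain ⟨O, hO, ⟨o, ho⟩, hOR⟩ := hcon
    have hOr : O ⊆ range fun x : F => x.1.1.1 := by
      rwa [← disjoint_iff_inter_eq_empty, disjoint_compl_right_iff_subset] at hOR
    obtain ⟨c, d, ⟨hc, hd⟩, hcd⟩ := mem_nhds_iff_exists_Ioo_subset.1 (hO.mem_nhds ho)
    obtain ⟨p, hp⟩ := exists_rat_btwn hc
    obtain ⟨q, hq⟩ := exists_rat_btwn hd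
    have hpqO : Ioo (p : ℝ) q ⊆ O := fun t ht => hcd ⟨hp.1.trans ht.1, ht.2.trans hq.2⟩
    obtain ⟨x, hx, hxF⟩ := hF' p q (by exact_mod_cast hp.2.trans hq.1) fun t ht => by
      obtain ⟨x, rfl⟩ := hOr (hpqO ht)
      exact h.fst_mem _ x.1.2
    -- Every graph point over the interval lies in `F`, and such points accumulate at `x`.
    refine hxF (hF.closure_subset (mem_closure_iff.2 fun N hN hxN => ?_))
    obtain ⟨W, hW, rfl⟩ := isOpen_induced_iff.1 hN
    -- a point of the graph near `x`
    obtain ⟨z, ⟨hzW, hzpq⟩, hzP, hzf⟩ := mem_closure_iff.1 (h.subset_closure x.2)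
      (W ∩ Prod.fst ⁻¹' Ioo (p : ℝ) q) (hW.inter (isOpen_Ioo.preimage continuous_fst)) ⟨hxN, hx⟩
    obtain ⟨w, hw⟩ := hOr (hpqO hzpq)
    have hwz : w.1.1 = z := by
      refine Prod.ext hw ?_
      obtain ⟨s, hs, hs1, hs2⟩ := h.mem_clusterValues (a := z.1) (y := w.1.1.2) (hw ▸ w.1.2)
      rw [hzf]
      exact tendsto_nhds_unique hs2 ((h.continuousOn z.1 hzP).tendsto.comp
        (tendsto_nhdsWithin_iff.2 ⟨hs1, Eventually.of_forall hs⟩))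
    exact ⟨w.1, show w.1.1 ∈ W from hwz ▸ hzW, w.2⟩

/-- For fixed `x`, the condition `x ∉ F` says that the closure of `e '' F` lies in the open set `{e
x}ᶜ`, which is open in the Vietoris topology; the criterion uses countably many unions of such
conditions. -/
theorem isGδ_zeroDimCloseds (h : IsHypergraph H I Q f) {K : Type*} [TopologicalSpace K]
    [T1Space K] {e : H → K} (he : IsEmbedding e) :
    @IsGδ (Closeds H) (admissibleTopology e) (zeroDimCloseds H) := by
  let := admissibleTopology e
  have hopen : ∀ x : H, IsOpen {F : Closeds H | x ∉ F} := by
    intro x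
    let := TopologicalSpace.vietoris K
    refine isOpen_induced_iff.2 ⟨({e x}ᶜ : Set K).powerset,
      isOpen_compl_singleton.powerset_vietoris, ?_⟩
    ext F
    have hF : x ∈ F ↔ e x ∈ closure (e '' (F : Set H)) := by
      have := he.isInducing.closure_eq_preimage_closure_image (F : Set H)
      rw [F.isClosed.closure_eq] at this
      exact Set.ext_iff.1 this x
    simp [hF]
  have heq : zeroDimCloseds H = ⋂ r : {r : ℚ × ℚ // r.1 < r.2 ∧ Ioo (r.1 : ℝ) r.2 ⊆ I},
      ⋃ x : {x : H // x.1.1 ∈ Ioo (r.1.1 : ℝ) r.1.2}, {F : Closeds H | (x : H) ∉ F} := by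
    ext F
    simp only [zeroDimCloseds, mem_ofPred_eq, mem_iInter, mem_iUnion,
      h.hasSmallInductiveDimensionLE_zero_iff F.isClosed]
    constructor
    · rintro hF ⟨⟨p, q⟩, hpq, hI⟩
      obtain ⟨x, hx, hxF⟩ := hF p q hpq hI
      exact ⟨⟨x, hx⟩, hxF⟩
    · intro hF p q hpq hI
      obtain ⟨⟨x, hx⟩, hxF⟩ := hF ⟨⟨p, q⟩, hpq, hI⟩
      exact ⟨x, hx, hxF⟩
  rw [heq]
  exact IsGδ.iInter_of_isOpen fun r => isOpen_iUnion fun x => hopen x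

/-! ### The category argument. -/

/-- A compact subset of `H` does not contain the part of `H` over an open interval that meets
`Q`. -/
theorem not_forall_mem_of_isCompact (h : IsHypergraph H I Q f) {F : Set H} (hF : IsCompact F)
    {J : Set ℝ} {a : ℝ} (haQ : a ∈ Q) (haJ : a ∈ J) : ∃ x : H, x.1.1 ∈ J ∧ x ∉ F := by
  by_contra! hcon
  have hcl : IsClosed (Subtype.val '' F : Set (ℝ × ℝ)) :=
    (hF.image continuous_subtype_val).isClosed
  have hall : ∀ y, y ∈ planeSection (closure (graphOver f (I \ Q))) a → (a, y) ∈ H := by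
    intro y hy
    -- The image of `F` is closed in the plane and contains the dense section `H(a)`, hence the
    -- whole section of the closure.
    have hyc := h.section_dense a haQ ⟨y, hy⟩
    have hsub : closure ((↑) ⁻¹' planeSection H a :
        Set ↥(planeSection (closure (graphOver f (I \ Q))) a)) ⊆
        (fun z : ↥(planeSection (closure (graphOver f (I \ Q))) a) => (a, (z : ℝ))) ⁻¹'
          (Subtype.val '' F) :=
      closure_minimal (fun z hz => ⟨⟨(a, z), hz⟩, hcon _ haJ, rfl⟩)
        (hcl.preimage (by fun_prop))
    obtain ⟨x, -, hx⟩ := hsub hyc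
    have hx' : x.1 = (a, y) := hx
    exact hx' ▸ x.2
  obtain ⟨y, hy⟩ := h.exists_mem (h.subset haQ)
  have hint := h.section_interior a haQ
  rw [show ((↑) ⁻¹' planeSection H a :
      Set ↥(planeSection (closure (graphOver f (I \ Q))) a)) = univ from
    eq_univ_of_forall fun z => hall z z.2, interior_univ] at hint
  exact hint.le (mem_univ ⟨y, h.subset_closure hy⟩)

theorem exists_Ioo_subset (h : IsHypergraph H I Q f) (hQ : ¬ IsNowhereDense Q) :
    ∃ p q : ℝ, p < q ∧ Ioo p q ⊆ I ∧ Ioo p q ⊆ closure Q := by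
  obtain ⟨x, hx⟩ := nonempty_iff_ne_empty.2 hQ
  obtain ⟨c, d, ⟨hc, hd⟩, hcd⟩ :=
    mem_nhds_iff_exists_Ioo_subset.1 (isOpen_interior.mem_nhds hx)
  have hcd' : Ioo c d ⊆ closure Q := hcd.trans interior_subset
  -- The endpoints are taken in `Q ⊆ I`, so that the interval between them lies in `I`.
  obtain ⟨p, hp, hpQ⟩ := mem_closure_iff.1 (interior_subset hx) _ isOpen_Ioo ⟨hc, hd⟩
  obtain ⟨m, hm⟩ := exists_between hp.2
  obtain ⟨q, hq, hqQ⟩ := mem_closure_iff.1 (hcd' ⟨hp.1.trans hm.1, hm.2⟩) (Ioo p d) isOpen_Ioo hm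
  exact ⟨p, q, hq.1, Ioo_subset_Icc_self.trans (h.ordConnected.out (h.subset hpQ) (h.subset hqQ)),
    fun t ht => hcd' ⟨hp.1.trans ht.1, ht.2.trans hq.2⟩⟩

theorem not_exists_iUnion (h : IsHypergraph H I Q f) (hGδ : IsGδ H) (hQ : ¬ IsNowhereDense Q) :
    ¬ ∃ F : ℕ → Set H,
      (∀ n, IsCompact (F n) ∨ (IsClosed (F n) ∧ HasSmallInductiveDimensionLE (F n) 0)) ∧
      ⋃ n, F n = univ := by
  rintro ⟨F, hF, hU⟩
  obtain ⟨p, q, hpq, hI, hcl⟩ := h.exists_Ioo_subset hQ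
  have : BaireSpace H := hGδ.baireSpace_of_t2Space_locallyCompactSpace
  have hFc : ∀ n, IsClosed (F n) := fun n => (hF n).elim (·.isClosed) (·.1)
  have hdense := dense_iUnion_interior_of_closed hFc hU
  obtain ⟨m, hm⟩ := exists_between hpq
  obtain ⟨y, hy⟩ := h.exists_mem (hI hm)
  have hop : IsOpen {x : H | x.1.1 ∈ Ioo p q} :=
    isOpen_Ioo.preimage (continuous_fst.comp continuous_subtype_val)
  obtain ⟨x, hx, hxF⟩ := hdense.inter_open_nonempty _ hop ⟨⟨(m, y), hy⟩, hm⟩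
  obtain ⟨n, hn⟩ := mem_iUnion.1 hxF
  obtain ⟨W, hW, hWF⟩ := isOpen_induced_iff.1 (isOpen_interior (s := F n))
  have hxW : x.1 ∈ W := by rw [← hWF] at hn; exact hn
  -- Pass to a graph point: only there does a neighbourhood `W` contain all of `H` over a short
  -- interval.
  obtain ⟨z, ⟨hzW, hzpq⟩, hzP, hzf⟩ := mem_closure_iff.1 (h.subset_closure x.2)
    (W ∩ Prod.fst ⁻¹' Ioo p q) (hW.inter (isOpen_Ioo.preimage continuous_fst)) ⟨hxW, hx⟩
  have hzW' : W ∈ 𝓝 (z.1, f z.1) := hW.mem_nhds (hzf ▸ hzW)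
  obtain ⟨c, d, ⟨hc, hd⟩, hcd⟩ := mem_nhds_iff_exists_Ioo_subset.1
    (inter_mem (isOpen_Ioo.mem_nhds hzpq) (h.eventually_forall_mem hzP hzW'))
  have hall : ∀ w : H, w.1.1 ∈ Ioo c d → w ∈ F n := fun w hw =>
    interior_subset (by
      rw [← hWF]
      exact (hcd hw).2 _ w.2)
  rcases hF n with hcomp | ⟨hclosed, hdim⟩
  · obtain ⟨a, ha, haQ⟩ := mem_closure_iff.1 (hcl hzpq) _ isOpen_Ioo ⟨hc, hd⟩
    obtain ⟨w, hw, hwF⟩ := h.not_forall_mem_of_isCompact hcomp haQ ha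
    exact hwF (hall w hw)
  · obtain ⟨r, hr⟩ := exists_rat_btwn hc
    obtain ⟨s, hs⟩ := exists_rat_btwn hd
    have hrs : Ioo (r : ℝ) s ⊆ Ioo c d := fun t ht => ⟨hr.1.trans ht.1, ht.2.trans hs.2⟩
    obtain ⟨w, hw, hwF⟩ := (h.hasSmallInductiveDimensionLE_zero_iff hclosed).1 hdim r s
      (by exact_mod_cast hr.2.trans hs.1) (fun t ht => hI (hcd (hrs ht)).1)
    exact hwF (hall w (hrs hw))

end IsHypergraph

theorem corollaryF0 (H : Set (ℝ × ℝ)) (I Q : Set ℝ) (f : ℝ → ℝ)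
    (hH : IsHypergraph H I Q f) (hGδ : IsGδ H) :
    (∀ (K : Type*) [TopologicalSpace K] [CompactSpace K] [MetrizableSpace K]
      (e : ↥H → K), IsEmbedding e →
        @IsGδ (Closeds ↥H) (admissibleTopology e) (zeroDimCloseds ↥H)) ∧
    (¬ IsNowhereDense Q →
      ¬ ∃ F : ℕ → Set ↥H,
        (∀ n, IsCompact (F n) ∨ (IsClosed (F n) ∧ HasSmallInductiveDimensionLE ↥(F n) 0)) ∧
        ⋃ n, F n = univ) :=
  ⟨fun _ _ _ _ _ he => hH.isGδ_zeroDimCloseds he, hH.not_exists_iUnion hGδ⟩
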